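/- An oriented matroid $\mathcal M=(E,\mathcal C)$ on a finite ground set $E$ is given by its set $\mathcal C\subseteq\{+,-,0\}^E$ of signed circuits (satisfying the oriented matroid circuit axioms); its rank is the size of a largest subset of $E$ containing no support of a circuit. For $X\in\mathcal C$ let $X^+$ and $X^-$ be its sets of positive and negative elements. For $k\ge 0$, $\mathcal M$ is $k$-neighborly if $|X^+|>k$ and $|X^-|>k$ for every circuit $X\in\mathcal C$. For $R\subseteq E$, the reorientation ${}_{-R}\mathcal M$ is obtained by reversing the sign of $X_e$ for all $e\in R$ and $X\in\mathcal C$; a $k$-neighborly reorientation of $\mathcal M$ is a subset $R\subseteq E$ such that ${}_{-R}\mathcal M$ is $k$-neighborly. Fix integers $k\ge 1$ and $r\ge 2k+2$. Then, as $n\to\infty$, every oriented matroid of rank $r$ on $n$ elements has at most $$2\binom{n}{r-1-2k}+O\!\left(n^{r-2-2k}\right)$$ $k$-neighborly reorientations, where the implied constant depends only on $r$ and $k$ (not on the oriented matroid). -/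

import Mathlib

/-- A sign vector on the ground set `E`, i.e. an element of `{+, -, 0}^E`. -/
abbrev SignVector (E : Type*) := E → SignType

namespace SignVector

variable {E : Type*} [Fintype E]

/-- The set `X⁺` of positive elements. -/
def pos (X : SignVector E) : Finset E := {e | X e = 1}

/-- The set `X⁻` of negative elements. -/
def neg (X : SignVector E) : Finset E := {e | X e = -1}

/-- The support of `X`, the set of elements with non-zero sign. -/
def support (X : SignVector E) : Finset E := {e | X e ≠ 0}

/-- The sign vector obtained from `X` by reversing the signs of the elements of `R`. -/
def reorient {E : Type*} [DecidableEq E] (R : Finset E) (X : SignVector E) : SignVector E :=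
  fun e => if e ∈ R then -X e else X e

end SignVector

/-- An oriented matroid on the finite ground set `E`, given by its signed circuits. -/
structure OrientedMatroid (E : Type*) [Fintype E] [DecidableEq E] where
  /-- The set of signed circuits. -/
  circuits : Set (SignVector E)
  zero_notMem : (0 : SignVector E) ∉ circuits
  neg_mem : ∀ X ∈ circuits, -X ∈ circuits
  eq_or_eq_neg : ∀ X ∈ circuits, ∀ Y ∈ circuits,
    X.support ⊆ Y.support → X = Y ∨ X = -Y
  elimination : ∀ X ∈ circuits, ∀ Y ∈ circuits, X ≠ -Y → ∀ e ∈ X.pos ∩ Y.neg,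
    ∃ Z ∈ circuits, Z.pos ⊆ (X.pos ∪ Y.pos).erase e ∧ Z.neg ⊆ (X.neg ∪ Y.neg).erase e

namespace SignVector

theorem reorient_reorient {E : Type*} [DecidableEq E] (R : Finset E) (X : SignVector E) :
    reorient R (reorient R X) = X := by
  funext e
  by_cases h : e ∈ R <;> simp [reorient, h]

theorem reorient_neg {E : Type*} [DecidableEq E] (R : Finset E) (X : SignVector E) :
    reorient R (-X) = -reorient R X := by
  funext e
  by_cases h : e ∈ R <;> simp [reorient, h]

variable {E : Type*} [Fintype E]

theorem mem_pos {X : SignVector E} {e : E} : e ∈ X.pos ↔ X e = 1 := by simp [pos]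

theorem mem_neg {X : SignVector E} {e : E} : e ∈ X.neg ↔ X e = -1 := by simp [neg]

theorem mem_support {X : SignVector E} {e : E} : e ∈ X.support ↔ X e ≠ 0 := by simp [support]

variable [DecidableEq E]

theorem support_reorient (R : Finset E) (X : SignVector E) :
    (reorient R X).support = X.support := by
  ext e
  rw [mem_support, mem_support, reorient]
  by_cases h : e ∈ R <;> cases hX : X e <;> simp [h]

theorem mem_pos_reorient (R : Finset E) (X : SignVector E) (e : E) :
    e ∈ (reorient R X).pos ↔ if e ∈ R then e ∈ X.neg else e ∈ X.pos := by
  simp only [mem_pos, mem_neg, reorient]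
  by_cases h : e ∈ R <;> cases hX : X e <;> simp [h]

theorem mem_neg_reorient (R : Finset E) (X : SignVector E) (e : E) :
    e ∈ (reorient R X).neg ↔ if e ∈ R then e ∈ X.pos else e ∈ X.neg := by
  simp only [mem_pos, mem_neg, reorient]
  by_cases h : e ∈ R <;> cases hX : X e <;> simp [h]

end SignVector

namespace OrientedMatroid

variable {E : Type*} [Fintype E] [DecidableEq E]

/-- A set is independent if it does not contain (the support of) a circuit. -/
def Indep (M : OrientedMatroid E) (I : Finset E) : Prop :=
  ∀ X ∈ M.circuits, ¬ X.support ⊆ I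

open Classical in
/-- The rank: the size of a largest set that does not contain a circuit. -/
noncomputable def rank (M : OrientedMatroid E) : ℕ :=
  (Finset.univ.filter fun I : Finset E => M.Indep I).sup Finset.card

/-- The reorientation of `M` along `R`: the signs of the elements of `R` are reversed in every
circuit. -/
def reorient (M : OrientedMatroid E) (R : Finset E) : OrientedMatroid E where
  circuits := SignVector.reorient R '' M.circuits
  zero_notMem := by
    rintro ⟨X, hX, h⟩
    have h0 : X = 0 := by
      rw [← SignVector.reorient_reorient R X, h]
      funext e
      simp [SignVector.reorient]
    exact M.zero_notMem (h0 ▸ hX)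
  neg_mem := by
    rintro _ ⟨X, hX, rfl⟩
    exact ⟨-X, M.neg_mem X hX, SignVector.reorient_neg R X⟩
  eq_or_eq_neg := by
    rintro _ ⟨X, hX, rfl⟩ _ ⟨Y, hY, rfl⟩ h
    rw [SignVector.support_reorient, SignVector.support_reorient] at h
    rcases M.eq_or_eq_neg X hX Y hY h with h | h
    · exact Or.inl (by rw [h])
    · exact Or.inr (by rw [h, SignVector.reorient_neg])
  elimination := by
    rintro _ ⟨X, hX, rfl⟩ _ ⟨Y, hY, rfl⟩ hne e he
    have hXY : X ≠ -Y := fun h => hne (by rw [h, SignVector.reorient_neg])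
    have key : ∃ Z ∈ M.circuits, Z.pos ⊆ (X.pos ∪ Y.pos).erase e ∧
        Z.neg ⊆ (X.neg ∪ Y.neg).erase e := by
      rw [Finset.mem_inter, SignVector.mem_pos_reorient, SignVector.mem_neg_reorient] at he
      by_cases heR : e ∈ R
      · simp only [heR, if_true] at he
        have hYX : Y ≠ -X := fun h => hXY (by rw [h, neg_neg])
        obtain ⟨Z, hZ, h1, h2⟩ := M.elimination Y hY X hX hYX e
          (Finset.mem_inter.2 ⟨he.2, he.1⟩)
        exact ⟨Z, hZ, by rwa [Finset.union_comm], by rwa [Finset.union_comm]⟩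
      · simp only [heR, if_false] at he
        exact M.elimination X hX Y hY hXY e (Finset.mem_inter.2 he)
    obtain ⟨Z, hZ, h1, h2⟩ := key
    refine ⟨_, ⟨Z, hZ, rfl⟩, ?_, ?_⟩
    · intro f hf
      have h1 := @h1 f
      have h2 := @h2 f
      simp only [Finset.mem_erase, Finset.mem_union, SignVector.mem_pos_reorient] at *
      split_ifs at * <;> tauto
    · intro f hf
      have h1 := @h1 f
      have h2 := @h2 f
      simp only [Finset.mem_erase, Finset.mem_union, SignVector.mem_neg_reorient] at *
      split_ifs at * <;> tauto

/-- `M` is `k`-neighborly if every circuit has more than `k` positive and more than `k` negative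
elements. -/
def IsNeighborly (M : OrientedMatroid E) (k : ℕ) : Prop :=
  ∀ X ∈ M.circuits, k < X.pos.card ∧ k < X.neg.card

open Classical in
/-- The number of `k`-neighborly reorientations of `M`, i.e. of subsets `R` of the ground set such
that the reorientation of `M` along `R` is `k`-neighborly. -/
noncomputable def numNeighborlyReorientations (M : OrientedMatroid E) (k : ℕ) : ℕ :=
  (Finset.univ.filter fun R : Finset E => (M.reorient R).IsNeighborly k).card

end OrientedMatroid

/-!
Write `f(M)` for the number of `k`-neighborly reorientations of `M`, and let `e` be an element.
Every neighborly reorientation of `M` restricts to one of the deletion `M \ e`. If `R` and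
`R ∪ {e}` are both neighborly for `M`, then `R` is neighborly for the contraction `M / e`: the two
reorientations give `e` opposite signs in each circuit, so `e` is never needed to reach the required
number of elements of a given sign. Hence `f(M) ≤ f(M \ e) + f(M / e)`, the recursion of the
binomial coefficients, and the leading constant `2` is decided in rank `2k + 1`. There every set `T`
of `2k + 2` elements contains a circuit, which neighborliness forces to have support `T` and `k + 1`
elements of either sign. The product of its signs is then `(-1)^(k+1)` for every neighborly `R`, so
two such `R` and `R'` have `|T ∩ (R ∆ R')|` even for all `T`. With more than `2k + 2` elements,
exchanging a single element of `T` shows that `R'` is `R` or its complement.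
-/

theorem subset_or_disjoint_of_even_card_inter {α : Type*} [DecidableEq α] {S D : Finset α} {m : ℕ}
    (hm : m + 1 < S.card) (h : ∀ T ⊆ S, T.card = m + 1 → Even (T ∩ D).card) :
    S ⊆ D ∨ Disjoint S D := by
  by_contra! hSD
  obtain ⟨f, hfS, hfD⟩ := Finset.not_subset.1 hSD.1
  obtain ⟨e, heS, heD⟩ := Finset.not_disjoint_iff.1 hSD.2
  have hef : e ≠ f := ne_of_mem_of_not_mem heD hfD
  have hcard : ((S.erase e).erase f).card = S.card - 1 - 1 := by
    rw [Finset.card_erase_of_mem (Finset.mem_erase.2 ⟨hef.symm, hfS⟩),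
      Finset.card_erase_of_mem heS]
  obtain ⟨T, hT, hTm⟩ := Finset.exists_subset_card_eq (s := (S.erase e).erase f) (n := m) (by lia)
  have hTS : T ⊆ S := hT.trans ((Finset.erase_subset _ _).trans (Finset.erase_subset _ _))
  have heT : e ∉ T := fun he => by simpa using hT he
  have hfT : f ∉ T := fun hf => by simpa using hT hf
  have heven_e : Even (insert e T ∩ D).card :=
    h _ (Finset.insert_subset heS hTS) (by rw [Finset.card_insert_of_notMem heT, hTm])
  have heven_f : Even (insert f T ∩ D).card :=
    h _ (Finset.insert_subset hfS hTS) (by rw [Finset.card_insert_of_notMem hfT, hTm])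
  rw [Finset.insert_inter_of_mem heD, Finset.card_insert_of_notMem (by simp [heT]),
    Nat.even_add_one] at heven_e
  rw [Finset.insert_inter_of_notMem hfD] at heven_f
  exact heven_e heven_f

theorem sum_range_succ_choose_succ (n j : ℕ) :
    ∑ i ∈ Finset.range (j + 1), (n + 1).choose i =
      ∑ i ∈ Finset.range (j + 1), n.choose i + ∑ i ∈ Finset.range j, n.choose i := by
  rw [Finset.sum_range_succ', Finset.sum_range_succ' (fun i => n.choose i)]
  simp only [Nat.choose_succ_succ, Finset.sum_add_distrib, Nat.choose_zero_right,
    Nat.succ_eq_add_one]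
  ring

theorem isBigO_sum_range_choose (j : ℕ) :
    (fun n : ℕ => ∑ i ∈ Finset.range (j + 1), (n.choose i : ℝ)) =O[Filter.atTop]
      fun n : ℕ => (n : ℝ) ^ j := by
  refine Asymptotics.IsBigO.fun_sum fun i hi => Asymptotics.IsBigO.of_bound 1 ?_
  filter_upwards [Filter.eventually_ge_atTop 1] with n hn
  have hchoose : n.choose i ≤ n ^ j :=
    (Nat.choose_le_pow n i).trans (Nat.pow_le_pow_right hn (Finset.mem_range_succ_iff.1 hi))
  rw [one_mul, Real.norm_of_nonneg (by positivity), Real.norm_of_nonneg (by positivity)]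
  exact_mod_cast hchoose

namespace SignVector

section Minors

open scoped Finset

variable {α : Type*}

theorem prod_eq_neg_one_pow {T : Finset α} {X : SignVector α} {m : ℕ} (hT : #T = 2 * m)
    (hX : ∀ s : SignType, s ≠ 0 → m ≤ #{e ∈ T | X e = s}) :
    ∏ e ∈ T, X e = (-1) ^ m := by
  classical
  have hpos := hX 1 (by decide)
  have hneg := hX (-1) (by decide)
  have hdisj : Disjoint {e ∈ T | X e = 1} {e ∈ T | X e = -1} :=
    Finset.disjoint_filter.2 fun e _ h1 h2 => absurd (h1.symm.trans h2) (by decide)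
  have hsub : {e ∈ T | X e = 1} ∪ {e ∈ T | X e = -1} ⊆ T :=
    Finset.union_subset (Finset.filter_subset _ _) (Finset.filter_subset _ _)
  have hcard := Finset.card_union_of_disjoint hdisj
  have hle := Finset.card_le_card hsub
  have hneg_eq : #{e ∈ T | X e = -1} = m := by lia
  calc ∏ e ∈ T, X e
      = (∏ e ∈ T with X e = 1, X e) * ∏ e ∈ T with X e = -1, X e := by
        rw [← Finset.prod_union hdisj, Finset.eq_of_subset_of_card_le hsub (by lia)]
    _ = 1 * (-1) ^ m := by
        rw [Finset.prod_eq_one fun e he => (Finset.mem_filter.1 he).2,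
          Finset.prod_eq_pow_card fun e he => (Finset.mem_filter.1 he).2, hneg_eq]
    _ = (-1) ^ m := one_mul _

variable [DecidableEq α] {C : Set (SignVector α)} {X : SignVector α} {S T R R' : Finset α}
  {k m j : ℕ} {e : α}

theorem reorient_eq_zero_iff : reorient R X e = 0 ↔ X e = 0 := by
  by_cases he : e ∈ R <;> simp [reorient, he]

theorem reorient_mul_reorient (hX : X e ≠ 0) :
    reorient R X e * reorient R' X e = if e ∈ symmDiff R R' then -1 else 1 := by
  have hsq : X e * X e = 1 := by
    generalize X e = s at hX ⊢
    decide +revert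
  by_cases he : e ∈ R <;> by_cases he' : e ∈ R' <;>
    simp [reorient, Finset.mem_symmDiff, he, he', hsq]

theorem card_filter_reorient_insert_le {s : SignType} (hR : ∀ f ∈ S, f ∈ R' ↔ f ∈ R)
    (hs : reorient R' X e ≠ s) :
    #{f ∈ insert e S | reorient R' X f = s} ≤ #{f ∈ S | reorient R X f = s} := by
  rw [Finset.filter_insert, if_neg hs]
  refine (congrArg Finset.card (Finset.filter_congr fun f hf => ?_)).le
  simp only [reorient, hR f hf]

open Classical in
/-- The `k`-neighborly reorientations of the trace on `S` of a family `C` of sign vectors: the sets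
`R ⊆ S` such that every member of `C`, reoriented along `R`, takes each non-zero sign more than `k`
times on `S`. The members of `C` may be non-zero outside `S`, so that contracting `e` amounts to
removing `e` from `S`, and deleting `e` to also restricting `C` to the members vanishing at `e`. -/
noncomputable def neighborlySets (C : Set (SignVector α)) (S : Finset α) (k : ℕ) :
    Finset (Finset α) :=
  {R ∈ S.powerset | ∀ X ∈ C, ∀ s : SignType, s ≠ 0 → k < #{e ∈ S | reorient R X e = s}}

/-- The trace of the family `C` on `S` has rank less than `m`: every `m`-subset of `S` is dependent,
i.e. contains the part in `S` of the support of a member of `C`. -/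
def RankLT (C : Set (SignVector α)) (S : Finset α) (m : ℕ) : Prop :=
  ∀ T ⊆ S, #T = m → ∃ X ∈ C, ∀ f ∈ S, X f ≠ 0 → f ∈ T

theorem mem_neighborlySets :
    R ∈ neighborlySets C S k ↔
      R ⊆ S ∧ ∀ X ∈ C, ∀ s : SignType, s ≠ 0 → k < #{e ∈ S | reorient R X e = s} := by
  simp [neighborlySets]

theorem card_neighborlySets_le_two_pow (C : Set (SignVector α)) (S : Finset α) (k : ℕ) :
    #(neighborlySets C S k) ≤ 2 ^ #S := by
  classical
  rw [← Finset.card_powerset]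
  exact Finset.card_le_card (Finset.filter_subset _ _)

theorem RankLT.delete (he : e ∉ S) (h : RankLT C (insert e S) m) :
    RankLT {X ∈ C | X e = 0} S m := by
  intro T hT hm
  obtain ⟨X, hX, hXT⟩ := h T (hT.trans (Finset.subset_insert _ _)) hm
  refine ⟨X, ⟨hX, ?_⟩, fun f hf => hXT f (Finset.mem_insert_of_mem hf)⟩
  by_contra hXe
  exact he (hT (hXT e (Finset.mem_insert_self _ _) hXe))

theorem RankLT.contract (he : e ∉ S) (h : RankLT C (insert e S) (m + 1)) : RankLT C S m := by
  intro T hT hm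
  obtain ⟨X, hX, hXT⟩ := h (insert e T) (Finset.insert_subset_insert _ hT)
    (by rw [Finset.card_insert_of_notMem (Finset.notMem_mono hT he), hm])
  exact ⟨X, hX, fun f hf hXf => Finset.mem_of_mem_insert_of_ne
    (hXT f (Finset.mem_insert_of_mem hf) hXf) (ne_of_mem_of_not_mem hf he)⟩

theorem erase_mem_neighborlySets_delete (he : e ∉ S) (hR : R ∈ neighborlySets C (insert e S) k) :
    R.erase e ∈ neighborlySets {X ∈ C | X e = 0} S k := by
  obtain ⟨hRS, hRk⟩ := mem_neighborlySets.1 hR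
  refine mem_neighborlySets.2 ⟨Finset.subset_insert_iff.1 hRS, fun X hX s hs => ?_⟩
  refine (hRk X hX.1 s hs).trans_le (card_filter_reorient_insert_le (fun f hf => ?_) ?_)
  · rw [Finset.mem_erase, and_iff_right (ne_of_mem_of_not_mem hf he)]
  · rw [reorient_eq_zero_iff.2 hX.2]
    exact hs.symm

theorem mem_neighborlySets_contract (he : e ∉ S) (heR : e ∉ R)
    (hR : R ∈ neighborlySets C (insert e S) k)
    (hReR : insert e R ∈ neighborlySets C (insert e S) k) :
    R ∈ neighborlySets C S k := by
  obtain ⟨hRS, hRk⟩ := mem_neighborlySets.1 hR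
  obtain ⟨-, hReRk⟩ := mem_neighborlySets.1 hReR
  refine mem_neighborlySets.2
    ⟨(Finset.subset_insert_iff_of_notMem heR).1 hRS, fun X hX s hs => ?_⟩
  -- The two reorientations give `e` opposite signs, so in one of them `e` does not have sign `s`.
  by_cases hXs : reorient R X e = s
  · refine (hReRk X hX s hs).trans_le (card_filter_reorient_insert_le (fun f hf => ?_) ?_)
    · rw [Finset.mem_insert, or_iff_right (ne_of_mem_of_not_mem hf he)]
    · have hneg : reorient (insert e R) X e = -s := by simp [← hXs, reorient, heR]
      rwa [hneg, Ne, SignType.neg_eq_self_iff]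
  · exact (hRk X hX s hs).trans_le (card_filter_reorient_insert_le (fun _ _ => Iff.rfl) hXs)

theorem card_neighborlySets_insert_le (C : Set (SignVector α)) (k : ℕ) (he : e ∉ S) :
    #(neighborlySets C (insert e S) k) ≤
      #(neighborlySets {X ∈ C | X e = 0} S k) + #(neighborlySets C S k) := by
  rw [← Finset.card_memberSubfamily_add_card_nonMemberSubfamily e,
    ← Finset.card_union_add_card_inter]
  refine add_le_add (Finset.card_le_card fun R hR => ?_) (Finset.card_le_card fun R hR => ?_)
  · rw [Finset.mem_union, Finset.mem_memberSubfamily, Finset.mem_nonMemberSubfamily] at hR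
    rcases hR with ⟨hR, heR⟩ | ⟨hR, heR⟩
    · simpa only [Finset.erase_insert heR] using erase_mem_neighborlySets_delete he hR
    · simpa only [Finset.erase_eq_of_notMem heR] using erase_mem_neighborlySets_delete he hR
  · rw [Finset.mem_inter, Finset.mem_memberSubfamily, Finset.mem_nonMemberSubfamily] at hR
    obtain ⟨⟨hReR, heR⟩, hR, -⟩ := hR
    exact mem_neighborlySets_contract he heR hR hReR

theorem prod_reorient_eq_neg_one_pow (hR : R ∈ neighborlySets C S k) (hX : X ∈ C)
    (hXT : ∀ f ∈ S, X f ≠ 0 → f ∈ T) (hT : #T = 2 * (k + 1)) :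
    ∏ e ∈ T, reorient R X e = (-1) ^ (k + 1) := by
  refine prod_eq_neg_one_pow hT fun s hs => ?_
  refine ((mem_neighborlySets.1 hR).2 X hX s hs).trans_le (Finset.card_le_card fun f hf => ?_)
  obtain ⟨hfS, hfs⟩ := Finset.mem_filter.1 hf
  exact Finset.mem_filter.2
    ⟨hXT f hfS fun hXf => hs (hfs.symm.trans (reorient_eq_zero_iff.2 hXf)), hfs⟩

theorem even_card_inter_symmDiff (hC : RankLT C S (2 * (k + 1))) (hR : R ∈ neighborlySets C S k)
    (hR' : R' ∈ neighborlySets C S k) (hTS : T ⊆ S) (hT : #T = 2 * (k + 1)) :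
    Even #(T ∩ symmDiff R R') := by
  obtain ⟨X, hX, hXT⟩ := hC T hTS hT
  have hprod := prod_reorient_eq_neg_one_pow hR hX hXT hT
  have hprod' := prod_reorient_eq_neg_one_pow hR' hX hXT hT
  have hX0 : ∀ e ∈ T, X e ≠ 0 := fun e he => by
    have hne : ∏ e ∈ T, reorient R X e ≠ 0 := hprod ▸ pow_ne_zero _ (by decide)
    exact mt reorient_eq_zero_iff.2 (Finset.prod_ne_zero_iff.1 hne e he)
  have hpow : (-1 : SignType) ^ #(T ∩ symmDiff R R') = 1 := calc
    (-1 : SignType) ^ #(T ∩ symmDiff R R')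
      = ∏ e ∈ T, if e ∈ symmDiff R R' then -1 else 1 := by
        rw [Finset.prod_ite_mem, Finset.prod_const]
    _ = ∏ e ∈ T, reorient R X e * reorient R' X e :=
        Finset.prod_congr rfl fun e he => (reorient_mul_reorient (hX0 e he)).symm
    _ = (-1) ^ (k + 1) * (-1) ^ (k + 1) := by rw [Finset.prod_mul_distrib, hprod, hprod']
    _ = 1 := by rw [← mul_pow, neg_one_mul, neg_neg, one_pow]
  by_contra hodd
  rw [(Nat.not_even_iff_odd.1 hodd).neg_one_pow] at hpow
  exact absurd hpow (by decide)

theorem card_neighborlySets_le_two (hC : RankLT C S (2 * (k + 1))) (hS : 2 * (k + 1) < #S) :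
    #(neighborlySets C S k) ≤ 2 := by
  rcases (neighborlySets C S k).eq_empty_or_nonempty with hempty | ⟨R, hR⟩
  · simp [hempty]
  refine (Finset.card_le_card (t := {R, S \ R}) fun R' hR' => ?_).trans Finset.card_le_two
  have hRS := (mem_neighborlySets.1 hR).1
  have hRS' := (mem_neighborlySets.1 hR').1
  rw [Finset.mem_insert, Finset.mem_singleton]
  rcases subset_or_disjoint_of_even_card_inter hS
    (fun T hTS hT => even_card_inter_symmDiff hC hR hR' hTS hT) with hsub | hdisj
  · right
    ext f
    have := @hsub f
    grind [Finset.mem_symmDiff]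
  · left
    ext f
    have := @Finset.disjoint_left.1 hdisj f
    grind [Finset.mem_symmDiff]

theorem card_neighborlySets_le_mul_sum_choose (C : Set (SignVector α)) (k j : ℕ) (hS : #S ≤ m) :
    #(neighborlySets C S k) ≤ 2 ^ m * ∑ i ∈ Finset.range (j + 1), (#S).choose i := by
  have hsum : 0 < ∑ i ∈ Finset.range (j + 1), (#S).choose i := by
    rw [Finset.sum_range_succ', Nat.choose_zero_right]
    exact Nat.succ_pos _
  calc #(neighborlySets C S k)
      ≤ 2 ^ #S := card_neighborlySets_le_two_pow C S k
    _ ≤ 2 ^ m := Nat.pow_le_pow_right two_pos hS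
    _ ≤ 2 ^ m * ∑ i ∈ Finset.range (j + 1), (#S).choose i := Nat.le_mul_of_pos_right _ hsum

-- For `j = 0` small `S` must be excluded: all `(2 * k + 2).choose (k + 1)` balanced sign patterns
-- occur when `S` is the support of a single circuit with `2 * k + 2` elements.
theorem card_neighborlySets_le (hC : RankLT C S (2 * (k + 1) + j))
    (hS : 2 * (k + 1) < #S ∨ 0 < j) :
    #(neighborlySets C S k) ≤
      2 * (#S).choose j + 2 ^ (2 * (k + 1) + 1) * ∑ i ∈ Finset.range j, (#S).choose i := by
  induction S using Finset.induction_on generalizing C j with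
  | empty =>
    obtain ⟨j, rfl⟩ := Nat.exists_eq_succ_of_ne_zero (hS.resolve_left (by simp)).ne'
    exact le_add_left (card_neighborlySets_le_mul_sum_choose C k j (by simp))
  | insert e S he ih =>
    obtain _ | j := j
    · simpa using card_neighborlySets_le_two hC (hS.resolve_right (lt_irrefl 0))
    rcases le_or_gt #(insert e S) (2 * (k + 1) + 1) with hsmall | hlarge
    · exact le_add_left (card_neighborlySets_le_mul_sum_choose C k j hsmall)
    rw [Finset.card_insert_of_notMem he] at hlarge ⊢
    have hdelete := ih (hC.delete he) (Or.inr j.succ_pos)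
    have hcontract := ih (RankLT.contract he hC) (Or.inl (Nat.lt_of_succ_lt_succ hlarge))
    have hinsert := card_neighborlySets_insert_le C k he
    rw [sum_range_succ_choose_succ, Nat.choose_succ_succ]
    linarith

end Minors

end SignVector

namespace OrientedMatroid

variable {E : Type*} [Fintype E] [DecidableEq E] (M : OrientedMatroid E)

theorem rankLT_circuits {m : ℕ} (hm : M.rank < m) :
    SignVector.RankLT M.circuits Finset.univ m := by
  classical
  intro T _ hT
  have hdep : ¬ M.Indep T := fun hindep =>
    hm.not_ge (hT ▸ Finset.le_sup (f := Finset.card) (by simpa using hindep))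
  simp only [Indep, not_forall, not_not] at hdep
  obtain ⟨X, hX, hXT⟩ := hdep
  exact ⟨X, hX, fun f _ hf => hXT (SignVector.mem_support.2 hf)⟩

theorem isNeighborly_reorient_iff (R : Finset E) (k : ℕ) :
    (M.reorient R).IsNeighborly k ↔ R ∈ SignVector.neighborlySets M.circuits Finset.univ k := by
  have hsigns : ∀ p : SignType → Prop, (∀ s, s ≠ 0 → p s) ↔ p 1 ∧ p (-1) := fun p =>
    ⟨fun h => ⟨h 1 (by decide), h (-1) (by decide)⟩, fun h s hs => by
      rcases s.trichotomy with rfl | rfl | rfl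
      exacts [h.2, absurd rfl hs, h.1]⟩
  simp only [SignVector.mem_neighborlySets, Finset.subset_univ, true_and, hsigns, IsNeighborly,
    reorient, Set.forall_mem_image, SignVector.pos, SignVector.neg]

theorem numNeighborlyReorientations_eq (k : ℕ) :
    M.numNeighborlyReorientations k =
      (SignVector.neighborlySets M.circuits Finset.univ k).card := by
  simp [numNeighborlyReorientations, isNeighborly_reorient_iff]

theorem numNeighborlyReorientations_le {k j : ℕ} (hM : M.rank < 2 * (k + 1) + j)
    (h : 2 * (k + 1) < Fintype.card E ∨ 0 < j) :
    M.numNeighborlyReorientations k ≤ 2 * (Fintype.card E).choose j +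
      2 ^ (2 * (k + 1) + 1) * ∑ i ∈ Finset.range j, (Fintype.card E).choose i := by
  rw [numNeighborlyReorientations_eq]
  exact SignVector.card_neighborlySets_le (M.rankLT_circuits hM) h

end OrientedMatroid

theorem mainTheorem3_general (k r : ℕ) (hr : 2 * k + 2 ≤ r) :
    ∃ g : ℕ → ℝ,
      Asymptotics.IsBigO Filter.atTop g (fun n : ℕ => (n : ℝ) ^ (r - 2 - 2 * k)) ∧
      ∀ (n : ℕ) (E : Type*) [Fintype E] [DecidableEq E] (M : OrientedMatroid E),
        Fintype.card E = n → M.rank ≤ r →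
        (M.numNeighborlyReorientations k : ℝ) ≤
          2 * (n.choose (r - 1 - 2 * k) : ℝ) + g n := by
  obtain ⟨j, rfl⟩ := Nat.exists_eq_add_of_le hr
  have hexp : 2 * k + 2 + j - 2 - 2 * k = j := by lia
  have hchoose : 2 * k + 2 + j - 1 - 2 * k = j + 1 := by lia
  rw [hexp, hchoose]
  refine ⟨_, (isBigO_sum_range_choose j).const_mul_left (2 ^ (2 * (k + 1) + 1)), ?_⟩
  rintro _ E _ _ M rfl hM
  exact_mod_cast M.numNeighborlyReorientations_le (k := k) (j := j + 1) (by lia)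
    (Or.inr j.succ_pos)

theorem mainTheorem3 (k r : ℕ) (hk : 1 ≤ k) (hr : 2 * k + 2 ≤ r) :
    ∃ g : ℕ → ℝ,
      Asymptotics.IsBigO Filter.atTop g (fun n : ℕ => (n : ℝ) ^ (r - 2 - 2 * k)) ∧
      ∀ (n : ℕ) (E : Type*) [Fintype E] [DecidableEq E] (M : OrientedMatroid E),
        Fintype.card E = n → M.rank = r →
        (M.numNeighborlyReorientations k : ℝ) ≤
          2 * (n.choose (r - 1 - 2 * k) : ℝ) + g n := by
  obtain ⟨g, hg, hbound⟩ := mainTheorem3_general k r hr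
  exact ⟨g, hg, fun n E _ _ M hn hM => hbound n E M hn hM.le⟩
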